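/- For a partition $\pi$ (a finite non-increasing sequence of positive integers) let $|\pi|$ be the sum of its parts, $f_i=f_i(\pi)$ the number of times $i$ appears as a part of $\pi$, $\nu_d(\pi)$ the number of different parts of $\pi$, and $\nu_{d,e}(\pi)$ the number of different even parts of $\pi$. Let $\chi(S)=1$ if the statement $S$ is true and $\chi(S)=0$ otherwise. Let $\tilde C$ be the set of all non-empty partitions with no parts divisible by $3$. Let $\mathcal R$ be the set of partitions $\pi$ for which there is an integer $n>0$ such that (i) all parts of $\pi$ are $\le 2n-1$; (ii) all positive even integers $\le 2n-2$ appear as parts of $\pi$; (iii) $f_n\ge 1+\chi(n\text{ is even})$; (iv) no even part $>n$ repeats. For $\pi\in\mathcal R$ this $n$ is unique: $n=n(\pi)=\frac12(\text{largest even part of }\pi)+1$, where the largest even part is read as $0$ if $\pi$ has no even part. Put $$\delta(\pi)=\sum_{j=1}^{n-1}\chi(f_{2j}>1),\qquad \gamma(\pi)=\bigl(\chi(n\text{ is even})+2f_n\,\chi(n\text{ is odd})\bigr)\prod_{j\ge 0,\;2j+1<n}(2f_{2j+1}+1),\qquad \mu(\pi)=2^{\delta(\pi)}\gamma(\pi).$$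 Let $\mathcal Q$ be the set of partitions $\pi$ for which there is an integer $n>0$ such that (i) the largest part of $\pi$ is $2n-1$; (ii) all positive odd integers $\le 2n-1$ appear as parts of $\pi$; (iii) no even integer $>n$ appears as a part of $\pi$. For $\pi\in\mathcal Q$ put $n=\frac12(\text{largest part of }\pi+1)$ and $$\eta(\pi)=2^{\nu_{d,e}(\pi)}\Bigl(\chi(n\text{ is even})\bigl(1+\chi(f_n=0)\bigr)+2f_n\,\chi(n\text{ is odd})\Bigr)\prod_{j\ge 0,\;2j+1<n}(2f_{2j+1}-1).$$ Then, as formal power series in $q$, $$\sum_{\pi\in\tilde C}2^{\nu_d(\pi)}q^{|\pi|}=\sum_{\pi\in\mathcal R}\mu(\pi)q^{|\pi|}=\sum_{\pi\in\mathcal Q}\eta(\pi)q^{|\pi|}.$$ -/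

import Mathlib

namespace WeightedPartitions

/-- The frequency `f_i(π)`: the number of appearances of the part `i` in `π`. -/
def freq {N : ℕ} (π : N.Partition) (i : ℕ) : ℕ := π.parts.count i

/-- The truth function: `1` if the statement is true, `0` otherwise. -/
def chi (P : Prop) [Decidable P] : ℤ := if P then 1 else 0

/-- The largest part of `π` (`0` for the empty partition). -/
def largestPart {N : ℕ} (π : N.Partition) : ℕ := π.parts.sup

/-- The largest even part of `π` (`0` if `π` has no even part). -/
def largestEvenPart {N : ℕ} (π : N.Partition) : ℕ := (π.parts.filter Even).sup

/-- The number `ν_d(π)` of different parts of `π`. -/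
def nuD {N : ℕ} (π : N.Partition) : ℕ := π.parts.toFinset.card

/-- The number `ν_{d,e}(π)` of different even parts of `π`. -/
def nuDE {N : ℕ} (π : N.Partition) : ℕ := (π.parts.toFinset.filter Even).card

/-- Membership in the set of non-empty partitions with no parts divisible by `3`. -/
def InC {N : ℕ} (π : N.Partition) : Prop :=
  π.parts ≠ 0 ∧ ∀ i ∈ π.parts, ¬ 3 ∣ i

/-- Membership in the set `R`. -/
def InR {N : ℕ} (π : N.Partition) : Prop :=
  ∃ n : ℕ, 0 < n ∧
    (∀ i ∈ π.parts, i ≤ 2 * n - 1) ∧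
    (∀ k : ℕ, 0 < k → Even k → k ≤ 2 * n - 2 → k ∈ π.parts) ∧
    (1 + chi (Even n) ≤ (freq π n : ℤ)) ∧
    (∀ k : ℕ, Even k → n < k → freq π k ≤ 1)

/-- The value `n(π)` attached to a partition in `R`. -/
def nR {N : ℕ} (π : N.Partition) : ℕ := largestEvenPart π / 2 + 1

/-- `δ(π) = ∑_{j=1}^{n-1} χ(f_{2j} > 1)`; natural-number valued, as it serves as an exponent. -/
def delta {N : ℕ} (π : N.Partition) : ℕ :=
  ∑ j ∈ Finset.Icc 1 (nR π - 1), if 1 < freq π (2 * j) then 1 else 0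

/-- The factor `γ(π)` of the weight on `R`. -/
def gamma {N : ℕ} (π : N.Partition) : ℤ :=
  (chi (Even (nR π)) + 2 * (freq π (nR π) : ℤ) * chi (Odd (nR π))) *
    ∏ j ∈ (Finset.range (nR π)).filter (fun j => 2 * j + 1 < nR π),
      (2 * (freq π (2 * j + 1) : ℤ) + 1)

/-- The weight `μ(π)` on `R`. -/
def mu {N : ℕ} (π : N.Partition) : ℤ := 2 ^ delta π * gamma π

/-- Membership in the set `Q`. -/
def InQ {N : ℕ} (π : N.Partition) : Prop :=
  ∃ n : ℕ, 0 < n ∧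
    largestPart π = 2 * n - 1 ∧
    (∀ k : ℕ, Odd k → k ≤ 2 * n - 1 → k ∈ π.parts) ∧
    (∀ k : ℕ, Even k → n < k → k ∉ π.parts)

/-- The value `n(π)` attached to a partition in `Q`. -/
def nQ {N : ℕ} (π : N.Partition) : ℕ := (largestPart π + 1) / 2

/-- The weight `η(π)` on `Q`. -/
def eta {N : ℕ} (π : N.Partition) : ℤ :=
  2 ^ nuDE π *
    (chi (Even (nQ π)) * (1 + chi (freq π (nQ π) = 0)) +
      2 * (freq π (nQ π) : ℤ) * chi (Odd (nQ π))) *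
    ∏ j ∈ (Finset.range (nQ π)).filter (fun j => 2 * j + 1 < nQ π),
      (2 * (freq π (2 * j + 1) : ℤ) - 1)

open Classical in
/-- The formal power series `∑_{π ∈ S} w(π) q^{|π|}`, for a set `S` of partitions given by its
membership predicate: the coefficient of `q^N` is the sum of the weights of the partitions of `N`
that lie in `S`. -/
noncomputable def weightedGF (S : ∀ {N : ℕ}, N.Partition → Prop)
    (w : ∀ {N : ℕ}, N.Partition → ℤ) : PowerSeries ℤ :=
  PowerSeries.mk fun N => ∑ π ∈ (Finset.univ : Finset N.Partition).filter (fun π => S π), w π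

end WeightedPartitions

/-! Write (a)_n for the q-Pochhammer symbol (a;q)_n. With n fixed, the conditions defining R, and
the weight μ, both factor over the part sizes i ≤ 2n-1: each i contributes a function of f_i alone
that vanishes when the condition at i fails. So the generating function for fixed n is a product of
one-variable series, and likewise for Q and η. Up to powers of q the factors for R and Q agree. The
powers add up to n² in both cases, as 2+4+...+(2n-2)+n for R and as 1+3+...+(2n-1) for Q. Hence both
have generating function q^{n²}(-1)_n(-q)_n/(q)_{2n} (`hyperTerm`), and since n is determined by π,
summing over n ≥ 1 gives R and Q.

On the side of partitions without multiples of 3 the product is ∏_{3∤i}(1+q^i)/(1-q^i), with the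
empty partition matching the term n = 0. It remains to prove ∑_{n≥0} q^{n²}(-1)_n(-q)_n/(q)_{2n} =
∏_{3∤i}(1+q^i)/(1-q^i). This is a Bailey pair argument. The finite triple product (`sum_thetaTerm`)
at z = 1, w = q expands (-1)_n(-q)_n/(q)_{2n} as a sum over s of theta terms divided by
(q)_{n-s}(q)_{n+s}. Summing over n by q-Vandermonde (`sum_bailey`) leaves a theta series with
exponents s(3s±1)/2, which the triple product in base q³ evaluates. The limit L → ∞ is taken modulo
X^M, where the Pochhammer inverses stabilize. -/

namespace WeightedPartitions

open Finset PowerSeries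

/-! ### Finite q-series identities -/

section FiniteIdentities

variable {R : Type*} [CommRing R]

/-- `p n` is the inverse of the `q`-Pochhammer symbol `(q; q)_n`. -/
structure IsInvPochhammer (q : R) (p : ℕ → R) : Prop where
  zero : p 0 = 1
  succ : ∀ n, (1 - q ^ (n + 1)) * p (n + 1) = p n

variable {q : R} {p : ℕ → R}

/-- A factor of a unit is a unit, starting from `p 0 = 1`. This permits cancellation even in
quotients by a power of X, which are not domains. -/
theorem IsInvPochhammer.isUnit (h : IsInvPochhammer q p) (n : ℕ) : IsUnit (p n) := by
  induction n with
  | zero => simp [h.zero]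
  | succ n ih => rw [← h.succ n] at ih; exact (isUnit_of_mul_isUnit_right ih)

theorem IsInvPochhammer.isUnit_one_sub (h : IsInvPochhammer q p) (n : ℕ) :
    IsUnit (1 - q ^ (n + 1)) := by
  have := h.isUnit n
  rw [← h.succ n] at this
  exact isUnit_of_mul_isUnit_left this

theorem IsInvPochhammer.map {S : Type*} [CommRing S] (h : IsInvPochhammer q p) (f : R →+* S) :
    IsInvPochhammer (f q) (fun n => f (p n)) :=
  ⟨by simp [h.zero], fun n => by rw [← h.succ n]; simp⟩

/-- Limiting case of the `q`-Chu-Vandermonde sum. -/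
theorem IsInvPochhammer.sum_vandermonde (h : IsInvPochhammer q p) (a t : ℕ) :
    ∑ s ∈ range (a + 1), q ^ (s * (s + t)) * (p (a - s) * p s * p (s + t)) =
      p a * p (a + t) := by
  induction a generalizing t with
  | zero => simp [h.zero]
  | succ a ih =>
    refine (h.isUnit_one_sub a).mul_left_cancel ?_
    -- Uses 1-q^{a+1} = q^s(1-q^{a+1-s}) + (1-q^s). The first piece vanishes at s = a+1 and the
    -- second at s = 0. After shifting the second, the two add up termwise to the sum for (a, t+1).
    have key : ∀ s ∈ range (a + 1 + 1), (1 - q ^ (a + 1)) *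
        (q ^ (s * (s + t)) * (p (a + 1 - s) * p s * p (s + t))) =
        q ^ (s * (s + t) + s) * ((1 - q ^ (a + 1 - s)) * p (a + 1 - s) * p s * p (s + t)) +
        q ^ (s * (s + t)) * (p (a + 1 - s) * ((1 - q ^ s) * p s) * p (s + t)) := by
      intro s hs
      obtain ⟨d, hd⟩ := Nat.exists_eq_add_of_le (mem_range_succ_iff.mp hs)
      have : a + 1 - s = d := by omega
      rw [this, hd]
      ring
    rw [mul_sum, sum_congr rfl key, sum_add_distrib, sum_range_succ, sum_range_succ' (n := a + 1)]
    simp only [Nat.sub_self, pow_zero, sub_self, zero_mul, mul_zero, add_zero]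
    rw [← sum_add_distrib, ← mul_assoc, h.succ a, show a + 1 + t = a + (t + 1) by ring, ← ih]
    refine sum_congr rfl fun s hs => ?_
    obtain ⟨d, rfl⟩ := Nat.exists_eq_add_of_le (mem_range_succ_iff.mp hs)
    rw [show s + d + 1 - s = d + 1 by omega, show s + d + 1 - (s + 1) = d by omega,
      show s + d - s = d by omega, h.succ d, h.succ s, show s + 1 + t = s + t + 1 by ring,
      ← h.succ (s + t), show s + (t + 1) = s + t + 1 by ring]
    ring

/-- The homogeneous `q`-binomial theorem. -/
theorem IsInvPochhammer.sum_qbinomial (h : IsInvPochhammer q p) (y z : R) (N : ℕ) :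
    ∑ j ∈ range (N + 1), p j * p (N - j) * (q ^ (j.choose 2) * z ^ j * y ^ (N - j)) =
      p N * ∏ k ∈ range N, (y + z * q ^ k) := by
  induction N with
  | zero => simp [h.zero]
  | succ N ih =>
    refine (h.isUnit_one_sub N).mul_left_cancel ?_
    -- Here 1-q^{N+1} = (1-q^{N+1-j}) + q^{N+1-j}(1-q^j). After shifting the second piece, the two
    -- assemble the new factor y + z q^N.
    have key : ∀ j ∈ range (N + 1 + 1), (1 - q ^ (N + 1)) *
        (p j * p (N + 1 - j) * (q ^ (j.choose 2) * z ^ j * y ^ (N + 1 - j))) =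
        p j * ((1 - q ^ (N + 1 - j)) * p (N + 1 - j)) *
          (q ^ (j.choose 2) * z ^ j * y ^ (N + 1 - j)) +
        ((1 - q ^ j) * p j) * p (N + 1 - j) *
          (q ^ (j.choose 2 + (N + 1 - j)) * z ^ j * y ^ (N + 1 - j)) := by
      intro j hj
      obtain ⟨d, hd⟩ := Nat.exists_eq_add_of_le (mem_range_succ_iff.mp hj)
      have : N + 1 - j = d := by omega
      rw [this, hd]
      ring
    rw [mul_sum, sum_congr rfl key, sum_add_distrib, sum_range_succ, sum_range_succ' (n := N + 1)]
    simp only [Nat.sub_self, pow_zero, sub_self, zero_mul, mul_zero, add_zero]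
    rw [← sum_add_distrib, ← mul_assoc, h.succ N, prod_range_succ, ← mul_assoc, ← ih, sum_mul]
    refine sum_congr rfl fun j hj => ?_
    obtain ⟨d, rfl⟩ := Nat.exists_eq_add_of_le (mem_range_succ_iff.mp hj)
    rw [show j + d + 1 - j = d + 1 by omega, show j + d + 1 - (j + 1) = d by omega,
      show j + d - j = d by omega, h.succ d, h.succ j, Nat.choose_succ_succ' j 1, Nat.choose_one_right]
    ring

theorem prod_const_range (x : R) (n : ℕ) : ∏ _k ∈ range n, x = x ^ n := by simp

/-- The symmetrized theta term: the terms of index `s` and `-s` of `∑ q ^ (s * (s - 1) / 2) * z ^ s`,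
where `w = q / z`. -/
def thetaTerm (q z w : R) (s : ℕ) : R :=
  if s = 0 then 1 else q ^ (s.choose 2) * (z ^ s + w ^ s)

theorem two_mul_choose_two (n : ℕ) : 2 * (n.choose 2) + n = n * n := by
  induction n with
  | zero => simp
  | succ n ih => rw [Nat.choose_succ_succ' n 1, Nat.choose_one_right]; linarith

theorem choose_two_add (a b : ℕ) : (a + b).choose 2 = a.choose 2 + a * b + b.choose 2 := by
  have h1 := two_mul_choose_two a
  have h2 := two_mul_choose_two b
  have h3 := two_mul_choose_two (a + b)
  nlinarith

theorem sum_range_eq_choose_two (n : ℕ) : ∑ k ∈ range n, k = n.choose 2 := by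
  rw [sum_range_id, Nat.choose_two_right]

/-- The finite form of the Jacobi triple product. -/
theorem IsInvPochhammer.sum_thetaTerm [IsDomain R] (h : IsInvPochhammer q p) {z w : R}
    (hq : q ≠ 0) (hz : z ≠ 0) (hzw : z * w = q) (n : ℕ) :
    ∑ s ∈ range (n + 1), p (n - s) * p (n + s) * thetaTerm q z w s =
      p (2 * n) * ∏ k ∈ range n, ((1 + z * q ^ k) * (1 + w * q ^ k)) := by
  -- This monomial is what must be extracted from the q-binomial product with y = q^n. For k < n, zw
  -- = q gives q^n + zq^k = zq^k(1+wq^{n-1-k}), while the remaining n factors are q^n(1+zq^k).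
  have hne : q ^ (n.choose 2 + n * n) * z ^ n ≠ 0 :=
    mul_ne_zero (pow_ne_zero _ hq) (pow_ne_zero _ hz)
  refine mul_left_cancel₀ hne ?_
  have hprod : q ^ (n.choose 2 + n * n) * z ^ n *
      ∏ k ∈ range n, ((1 + z * q ^ k) * (1 + w * q ^ k)) =
      ∏ k ∈ range (2 * n), (q ^ n + z * q ^ k) := by
    have h1 : ∏ k ∈ range n, (q ^ n + z * q ^ k) =
        q ^ (n.choose 2) * z ^ n * ∏ k ∈ range n, (1 + w * q ^ k) := by
      rw [← prod_range_reflect (fun k => 1 + w * q ^ k), ← sum_range_eq_choose_two,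
        ← prod_pow_eq_pow_sum]
      rw [← prod_const_range z, ← prod_mul_distrib, ← prod_mul_distrib]
      refine prod_congr rfl fun k hk => ?_
      obtain ⟨d, rfl⟩ := Nat.exists_eq_add_of_lt (mem_range.mp hk)
      rw [show k + d + 1 - 1 - k = d by omega]
      simp only [pow_add, pow_one]
      linear_combination (-(q ^ k * q ^ d)) * hzw
    have h2 : ∏ k ∈ range n, (q ^ n + z * q ^ (n + k)) =
        q ^ (n * n) * ∏ k ∈ range n, (1 + z * q ^ k) := by
      rw [pow_mul, ← prod_const_range (q ^ n), ← prod_mul_distrib]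
      exact prod_congr rfl fun k hk => by ring
    rw [two_mul, prod_range_add, h1, h2, prod_mul_distrib]
    ring
  have hbin := h.sum_qbinomial (q ^ n) z (2 * n)
  rw [← hprod] at hbin
  -- Split the binomial sum at its centre j = n and reverse the lower half, so that the indices
  -- n-(s+1) and n+(s+1) pair into one theta term.
  rw [mul_left_comm, ← hbin, sum_range_succ', show 2 * n + 1 = n + (n + 1) by ring,
    sum_range_add (n := n) (m := n + 1), ← sum_range_reflect (n := n) (f := fun j => p j * _ * _),
    sum_range_succ' (n := n) (f := fun x => p (n + x) * _ * _), mul_add, mul_sum,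
    ← add_assoc, ← sum_add_distrib]
  congr 1
  · refine sum_congr rfl fun s hs => ?_
    obtain ⟨d, rfl⟩ := Nat.exists_eq_add_of_lt (mem_range.mp hs)
    have e1 : s + d + 1 - 1 - s = d := by omega
    have e2 : 2 * (s + d + 1) - d = s + 1 + d + 1 + s := by omega
    have e3 : 2 * (s + d + 1) - (s + d + 1 + (s + 1)) = d := by omega
    have e4 : s + d + 1 - (s + 1) = d := by omega
    have e5 : s + d + 1 + (s + 1) = s + 1 + d + 1 + s := by omega
    rw [e1, e2, e3, e4, e5, thetaTerm, if_neg (by omega)]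
    have c1 : (s + d + 1).choose 2 = d.choose 2 + d * (s + 1) + (s + 1).choose 2 := by
      rw [← choose_two_add]; congr 1; omega
    have c2 : (s + 1 + d + 1 + s).choose 2 =
        (s + d + 1).choose 2 + (s + d + 1) * (s + 1) + (s + 1).choose 2 := by
      rw [← choose_two_add]; congr 1; omega
    have c3 := two_mul_choose_two (s + 1)
    have hw : z ^ (s + d + 1) * w ^ (s + 1) = z ^ d * q ^ (s + 1) := by
      rw [← hzw, mul_pow]; ring
    have hz' : z ^ (s + 1 + d + 1 + s) = z ^ (s + d + 1) * z ^ (s + 1) := by ring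
    have x1 : q ^ (d.choose 2) * (q ^ (s + d + 1)) ^ (s + 1 + d + 1 + s) =
        q ^ ((s + d + 1).choose 2 + (s + d + 1) * (s + d + 1)) * q ^ ((s + 1).choose 2) *
          q ^ (s + 1) := by
      rw [← pow_mul, ← pow_add, ← pow_add, ← pow_add]
      congr 1
      rw [c1]
      nlinarith
    have x2 : q ^ ((s + 1 + d + 1 + s).choose 2) * (q ^ (s + d + 1)) ^ d =
        q ^ ((s + d + 1).choose 2 + (s + d + 1) * (s + d + 1)) * q ^ ((s + 1).choose 2) := by
      rw [← pow_mul, ← pow_add, ← pow_add]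
      congr 1
      rw [c2]
      ring
    rw [hz']
    linear_combination (-(p d * p (s + 1 + d + 1 + s) * z ^ d)) * x1 -
      (p d * p (s + 1 + d + 1 + s) * z ^ (s + d + 1) * z ^ (s + 1)) * x2 +
      (p d * p (s + 1 + d + 1 + s) *
        q ^ ((s + d + 1).choose 2 + (s + d + 1) * (s + d + 1)) * q ^ ((s + 1).choose 2)) * hw
  · rw [thetaTerm, if_pos rfl, add_zero, Nat.sub_zero, show 2 * n - n = n by omega]
    ring

/-- The finite Bailey-type identity. -/
theorem IsInvPochhammer.sum_bailey (h : IsInvPochhammer q p) (A : ℕ → R) (L : ℕ) :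
    ∑ n ∈ range (L + 1), q ^ (n * n) * p (L - n) *
        ∑ s ∈ range (n + 1), p (n - s) * p (n + s) * A s =
      ∑ s ∈ range (L + 1), q ^ (s * s) * A s * (p (L - s) * p (L + s)) := by
  simp only [mul_sum]
  rw [sum_comm' (t' := range (L + 1)) (s' := fun s => Ico s (L + 1))
    (by intro n s; simp only [mem_range, mem_Ico]; omega)]
  refine sum_congr rfl fun s hs => ?_
  obtain ⟨d, rfl⟩ := Nat.exists_eq_add_of_le (mem_range_succ_iff.mp hs)
  have hv := h.sum_vandermonde d (2 * s)
  -- For fixed s the inner sum over n = s + m is q-Vandermonde with a = L-s and t = 2s, because n² =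
  -- s² + m(m+2s).
  rw [show s + d - s = d by omega, show s + d + s = d + 2 * s by ring, ← hv, mul_sum,
    sum_Ico_eq_sum_range, show s + d + 1 - s = d + 1 by omega]
  refine sum_congr rfl fun m hm => ?_
  rw [show s + d - (s + m) = d - m by omega, show s + m - s = m by omega,
    show s + m + s = m + 2 * s by ring]
  ring

end FiniteIdentities

/-! ### Geometric series and Pochhammer inverses as power series -/

/-- The power series `∑ c, w c * X ^ (i * c)`. -/
noncomputable def dilate (i : ℕ) (w : ℕ → ℤ) : PowerSeries ℤ :=
  PowerSeries.mk fun k => if i ∣ k then w (k / i) else 0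

theorem dilate_eq_expand {i : ℕ} (hi : i ≠ 0) (w : ℕ → ℤ) :
    dilate i w = PowerSeries.expand i hi (PowerSeries.mk w) := by
  ext k
  rw [dilate, coeff_mk, coeff_expand]
  split_ifs <;> simp

/-- The geometric series `1 / (1 - X ^ i)`. -/
noncomputable def geom (i : ℕ) : PowerSeries ℤ := dilate i 1

theorem one_sub_mul_geom {i : ℕ} (hi : i ≠ 0) : (1 - X ^ i) * geom i = 1 := by
  have h := congrArg (PowerSeries.expand i hi) (mk_one_mul_one_sub_eq_one ℤ)
  rw [map_mul, map_sub, map_one, expand_X, ← dilate_eq_expand] at h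
  rwa [mul_comm]

/-- The inverse of the Pochhammer symbol `(X ^ c; X ^ c)_n`. -/
noncomputable def invPoch (c n : ℕ) : PowerSeries ℤ := ∏ k ∈ range n, geom (c * (k + 1))

theorem isInvPochhammer_invPoch {c : ℕ} (hc : c ≠ 0) :
    IsInvPochhammer (X ^ c) (invPoch c) := by
  refine ⟨by simp [invPoch], fun n => ?_⟩
  have h : (1 - X ^ (c * (n + 1))) * geom (c * (n + 1)) = 1 :=
    one_sub_mul_geom (mul_ne_zero hc n.succ_ne_zero)
  rw [← pow_mul, invPoch, prod_range_succ, mul_left_comm, h, mul_one, invPoch]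

/-! ### The infinite identity, modulo powers of X -/

/-- Once q^M = 0, every further factor 1-q^{n+1} equals 1. This replaces convergence to the infinite
product. -/
theorem IsInvPochhammer.eq_of_le {S : Type*} [CommRing S] {q : S} {p : ℕ → S}
    (h : IsInvPochhammer q p) {M : ℕ} (hM : q ^ M = 0) {n : ℕ} (hn : M ≤ n) : p n = p M := by
  induction n, hn using Nat.le_induction with
  | base => rfl
  | succ n hn ih => rw [← ih, ← h.succ n, pow_eq_zero_of_le (by omega) hM, sub_zero, one_mul]

/-- The `n`-th term of the `q`-hypergeometric series. -/
noncomputable def hyperTerm (n : ℕ) : PowerSeries ℤ :=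
  X ^ (n * n) * invPoch 1 (2 * n) * ∏ k ∈ range n, ((1 + X ^ k) * (1 + X ^ (k + 1)))

/-- The summands of the theta series `∑ X ^ (s * (3 * s + 1) / 2)`, symmetrized in `s`. -/
noncomputable def pentagonalTerm (s : ℕ) : PowerSeries ℤ := thetaTerm (X ^ 3) X (X ^ 2) s

/-- The link between the two triple products: the base-q³ theta term is the base-q term at (z, w) =
(1, q) times the Bailey factor q^{s²}, by s² = 2·C(s,2) + s. -/
theorem pentagonalTerm_eq (s : ℕ) :
    pentagonalTerm s = X ^ (s * s) * thetaTerm (X : PowerSeries ℤ) 1 X s := by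
  rw [pentagonalTerm, thetaTerm, thetaTerm]
  split_ifs with h
  · simp [h]
  · rw [← two_mul_choose_two s]
    ring

theorem sum_hyperTerm (L : ℕ) :
    ∑ n ∈ range (L + 1), invPoch 1 (L - n) * hyperTerm n =
      ∑ s ∈ range (L + 1), pentagonalTerm s * (invPoch 1 (L - s) * invPoch 1 (L + s)) := by
  have h : IsInvPochhammer (X : PowerSeries ℤ) (invPoch 1) := by
    simpa using isInvPochhammer_invPoch one_ne_zero
  simp only [pentagonalTerm_eq]
  rw [← h.sum_bailey]
  refine sum_congr rfl fun n _ => ?_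
  rw [h.sum_thetaTerm X_ne_zero one_ne_zero (one_mul _), hyperTerm]
  simp only [one_mul, ← pow_succ']
  ring

theorem sum_pentagonalTerm (L : ℕ) :
    ∑ s ∈ range (L + 1), pentagonalTerm s * (invPoch 3 (L - s) * invPoch 3 (L + s)) =
      invPoch 3 (2 * L) *
        ∏ k ∈ range L, ((1 + X ^ (3 * k + 1)) * (1 + X ^ (3 * k + 2))) := by
  have h := (isInvPochhammer_invPoch three_ne_zero).sum_thetaTerm (z := X) (w := X ^ 2)
    (pow_ne_zero _ X_ne_zero) X_ne_zero (by ring) L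
  convert h using 1
  · exact sum_congr rfl fun s _ => mul_comm _ _
  · congr 1
    refine prod_congr rfl fun k _ => ?_
    ring

/-- Sorts the factors of (q;q)_{3L} by residue modulo 3. -/
theorem invPoch_three_mul (L : ℕ) :
    invPoch 1 (3 * L) =
      invPoch 3 L * ∏ k ∈ range L, (geom (3 * k + 1) * geom (3 * k + 2)) := by
  induction L with
  | zero => simp [invPoch]
  | succ L ih =>
    rw [invPoch] at ih
    rw [invPoch, show 3 * (L + 1) = 3 * L + 1 + 1 + 1 by ring]
    simp only [prod_range_succ, ih]
    rw [invPoch, invPoch, prod_range_succ]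
    ring_nf

/-- Stabilization of a sum modulo a power of `q`. -/
theorem sum_eq_of_stable {S : Type*} [CommRing S] {M L : ℕ} (hL : M ≤ L + 1) {u v : ℕ → S} {c : S}
    (hu : ∀ n, M ≤ n → u n = 0) (hv : ∀ n < M, v n = c) :
    ∑ n ∈ range (L + 1), u n * v n = (∑ n ∈ range M, u n) * c := by
  rw [sum_mul]
  symm
  refine sum_subset_zero_on_sdiff (range_mono hL) (fun n hn => ?_) (fun n hn => ?_)
  · rw [hu n (by simpa using (mem_sdiff.mp hn).2), zero_mul]
  · rw [hv n (mem_range.mp hn)]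

theorem X_pow_dvd_sum_hyperTerm_sub (M : ℕ) :
    (X : PowerSeries ℤ) ^ M ∣ ∑ n ∈ range M, hyperTerm n -
      ∏ k ∈ range (2 * M), (((1 + X ^ (3 * k + 1)) * (1 + X ^ (3 * k + 2))) *
        (geom (3 * k + 1) * geom (3 * k + 2))) := by
  rw [← Ideal.mem_span_singleton, ← Ideal.Quotient.eq]
  set f := Ideal.Quotient.mk (Ideal.span {(X : PowerSeries ℤ) ^ M}) with hf
  have hX : f X ^ M = 0 := by
    rw [← map_pow, hf, Ideal.Quotient.eq_zero_iff_mem]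
    exact Ideal.mem_span_singleton_self _
  have hX' : ∀ n, M ≤ n → f X ^ (n * n) = 0 := fun n hn =>
    pow_eq_zero_of_le (hn.trans (Nat.le_mul_self n)) hX
  have h1 : IsInvPochhammer (f X) (fun n => f (invPoch 1 n)) := by
    simpa using (isInvPochhammer_invPoch one_ne_zero).map f
  have h3 : IsInvPochhammer (f X ^ 3) (fun n => f (invPoch 3 n)) := by
    simpa using (isInvPochhammer_invPoch three_ne_zero).map f
  have hX3 : (f X ^ 3) ^ M = 0 := by
    rw [← pow_mul]
    exact pow_eq_zero_of_le (by omega) hX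
  have e1 : ∀ n, M ≤ n → f (invPoch 1 n) = f (invPoch 1 M) := fun n hn => h1.eq_of_le hX hn
  have e3 : ∀ n, M ≤ n → f (invPoch 3 n) = f (invPoch 3 M) := fun n hn => h3.eq_of_le hX3 hn
  have hhyp : ∀ n, M ≤ n → f (hyperTerm n) = 0 := fun n hn => by
    rw [hyperTerm, map_mul, map_mul, map_pow, hX' n hn, zero_mul, zero_mul]
  have hpent : ∀ n, M ≤ n → f (pentagonalTerm n) = 0 := fun n hn => by
    rw [pentagonalTerm_eq, map_mul, map_pow, hX' n hn, zero_mul]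
  -- With L = 2M, all indices 2M-n and 2M+n for n < M are at least M, so the Pochhammer inverses are
  -- constant there, while the terms with n ≥ M vanish.
  have i1 := congrArg f (sum_hyperTerm (2 * M))
  have i2 := congrArg f (sum_pentagonalTerm (2 * M))
  have i3 := congrArg f (invPoch_three_mul (2 * M))
  simp only [map_sum, map_mul (f := f)] at i1 i2 i3
  simp_rw [mul_comm (f (invPoch 1 _)) (f (hyperTerm _))] at i1
  rw [sum_eq_of_stable (c := f (invPoch 1 M)) (by omega) hhyp fun n hn => e1 _ (by omega),
    sum_eq_of_stable (c := f (invPoch 1 M) * f (invPoch 1 M)) (by omega) hpent fun n hn => by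
      rw [e1 (2 * M - n) (by omega), e1 (2 * M + n) (by omega)], ← mul_assoc] at i1
  rw [sum_eq_of_stable (c := f (invPoch 3 M) * f (invPoch 3 M)) (by omega) hpent fun n hn => by
      rw [e3 (2 * M - n) (by omega), e3 (2 * M + n) (by omega)], ← mul_assoc, mul_comm,
    e3 (2 * (2 * M)) (by omega)] at i2
  rw [e1 (3 * (2 * M)) (by omega), e3 (2 * M) (by omega)] at i3
  replace i1 := (h1.isUnit M).mul_right_cancel i1
  replace i2 := (h3.isUnit M).mul_left_cancel i2
  rw [map_sum, i1, i3, ← mul_assoc, i2, ← map_mul, ← prod_mul_distrib]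

/-! ### Generating functions from local weights -/

/-- A partition corresponds to the decomposition N = ∑ i·f_i. A decomposition not of this kind has
some summand not divisible by its i, and then `dilate` contributes 0. -/
theorem coeff_prod_dilate (w : ℕ → ℕ → ℤ) (M N : ℕ) :
    coeff N (∏ i ∈ Icc 1 M, dilate i (w i)) =
      ∑ π : N.Partition with ∀ i ∈ π.parts, i ≤ M, ∏ i ∈ Icc 1 M, w i (freq π i) := by
  rw [coeff_prod]
  symm
  refine sum_of_injOn Nat.Partition.toFinsuppAntidiag
    (Nat.Partition.toFinsuppAntidiag_injective N).injOn ?_ ?_ ?_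
  · intro π hπ
    simp only [coe_filter, mem_univ, true_and, Set.mem_ofPred_eq] at hπ
    have h1 : π.parts.toFinset ⊆ Icc 1 M := fun i hi => by
      rw [Multiset.mem_toFinset] at hi
      exact mem_Icc.mpr ⟨π.parts_pos hi, hπ i hi⟩
    rw [mem_coe, mem_finsuppAntidiag]
    refine ⟨?_, h1⟩
    conv_rhs => rw [← π.parts_sum, sum_multiset_count]
    symm
    refine sum_subset h1 fun i _ hi => ?_
    rw [Multiset.mem_toFinset] at hi
    simp [hi]
  · intro l hl hl'
    by_contra hne
    rw [← Ne, prod_ne_zero_iff] at hne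
    apply hl'
    rw [mem_finsuppAntidiag] at hl
    have hdvd : ∀ i, i ∣ l i := fun i => by
      by_cases hi : i ∈ Icc 1 M
      · have := hne i hi
        rw [dilate, coeff_mk] at this
        by_contra h
        simp [h] at this
      · have : l i = 0 := by
          by_contra h
          exact hi (hl.2 (Finsupp.mem_support_iff.mpr h))
        simp [this]
    have hpos : ∀ i ∈ l.support, i ≠ 0 ∧ i ≤ M := fun i hi => by
      have := mem_Icc.mp (hl.2 hi)
      omega
    let m : ℕ →₀ ℕ := Finsupp.onFinset l.support (fun i => l i / i) (fun i hi => by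
      rw [Finsupp.mem_support_iff]
      rintro h
      simp [h] at hi)
    have hm : ∀ i, m i = l i / i := fun i => rfl
    have hsub : m.support ⊆ l.support := Finsupp.support_onFinset_subset
    refine ⟨⟨Finsupp.toMultiset m, fun {i} hi => ?_, ?_⟩, ?_, ?_⟩
    · rw [Finsupp.mem_toMultiset] at hi
      exact Nat.pos_of_ne_zero (hpos i (hsub hi)).1
    · rw [sum_multiset_count, Finsupp.toFinset_toMultiset, ← hl.1,
        sum_subset (hsub.trans hl.2) fun i _ hi => ?_]
      · refine sum_congr rfl fun i _ => ?_
        rw [Finsupp.count_toMultiset, hm, smul_eq_mul, Nat.div_mul_cancel (hdvd i)]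
      · rw [Finsupp.count_toMultiset, Finsupp.notMem_support_iff.mp hi, zero_smul]
    · simp only [coe_filter, mem_univ, true_and, Set.mem_ofPred_eq]
      intro i hi
      rw [Finsupp.mem_toMultiset] at hi
      exact (hpos i (hsub hi)).2
    · ext i
      simp only [Nat.Partition.toFinsuppAntidiag, Finsupp.coe_mk, Finsupp.count_toMultiset, hm]
      exact Nat.div_mul_cancel (hdvd i)
  · intro π _
    refine prod_congr rfl fun i hi => ?_
    have : 0 < i := (mem_Icc.mp hi).1
    simp [dilate, Nat.Partition.toFinsuppAntidiag, freq, this]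

/-- Multiplication by the geometric series takes partial sums of the coefficients. -/
theorem dilate_eq_mul_geom {i : ℕ} (hi : i ≠ 0) {w v : ℕ → ℤ} (h0 : w 0 = v 0)
    (hs : ∀ c, w (c + 1) = w c + v (c + 1)) : dilate i w = dilate i v * geom i := by
  have h : PowerSeries.mk w * (1 - X) = PowerSeries.mk v := by
    ext c
    cases c with
    | zero => simp [mul_sub, h0]
    | succ c => rw [mul_sub, map_sub, mul_one, coeff_succ_mul_X]; simp [hs]
  have h' := congrArg (PowerSeries.expand i hi) h
  rw [map_mul, map_sub, map_one, expand_X, ← dilate_eq_expand, ← dilate_eq_expand] at h'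
  rw [← h', mul_assoc, one_sub_mul_geom hi, mul_one]

/-- The coefficients of a quadratic polynomial. -/
def quadCoeff (a b d : ℤ) (c : ℕ) : ℤ :=
  if c = 0 then a else if c = 1 then b else if c = 2 then d else 0

theorem dilate_quadCoeff {i : ℕ} (hi : i ≠ 0) (a b d : ℤ) :
    dilate i (quadCoeff a b d) = C a + C b * X ^ i + C d * (X ^ i) ^ 2 := by
  have h : PowerSeries.mk (quadCoeff a b d) = C a + C b * X + C d * X ^ 2 := by
    ext c
    rw [map_add, map_add, coeff_C_mul, coeff_C_mul, coeff_C, coeff_X, coeff_X_pow, coeff_mk]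
    rcases c with _ | _ | _ | c <;> simp [quadCoeff]
  rw [dilate_eq_expand hi, h]
  simp

theorem dilate_eq_quad_mul_geom {i : ℕ} (hi : i ≠ 0) (a b d : ℤ) {w : ℕ → ℤ} (h0 : w 0 = a)
    (h1 : w 1 = a + b) (h2 : ∀ c, w (c + 2) = a + b + d) :
    dilate i w = (C a + C b * X ^ i + C d * (X ^ i) ^ 2) * geom i := by
  rw [← dilate_quadCoeff hi]
  refine dilate_eq_mul_geom hi (by simp [h0, quadCoeff]) fun c => ?_
  rcases c with _ | _ | c
  · simp [h0, h1, quadCoeff]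
  · simp [h1, h2 0, quadCoeff]
  · rw [h2 c, show c + 2 + 1 = c + 1 + 2 by ring, h2 (c + 1)]
    simp [quadCoeff]

theorem dilate_eq_quad_mul_geom_sq {i : ℕ} (hi : i ≠ 0) (a b d : ℤ) {w : ℕ → ℤ} (h0 : w 0 = a)
    (h1 : ∀ c : ℕ, w (c + 1) = a * (c + 2) + b * (c + 1) + d * c) :
    dilate i w = (C a + C b * X ^ i + C d * (X ^ i) ^ 2) * geom i * geom i := by
  -- The intermediate sequence consists of the partial sums of (a, b, d, 0, ...); summing once more
  -- gives the affine w.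
  rw [← dilate_eq_quad_mul_geom hi a b d
    (w := fun c => if c = 0 then a else if c = 1 then a + b else a + b + d)
    (by simp) (by simp) (by simp)]
  refine dilate_eq_mul_geom hi (by simp [h0]) fun c => ?_
  rcases c with _ | c
  · simp [h0, h1]; ring
  · rw [h1, h1]; simp; ring

/-! ### Local weights and their series -/

/-- The local weights whose product is the weight `mu` on partitions in `R` with parameter `n`. -/
def weightR (n i c : ℕ) : ℤ :=
  if i < n then if Even i then (if c = 0 then 0 else if c = 1 then 1 else 2) else 2 * c + 1
  else if i = n then if Even i then (if c < 2 then 0 else 2) else 2 * c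
  else if Even i then (if c = 1 then 1 else 0) else 1

/-- The local weights whose product is the weight `eta` on partitions in `Q` with parameter `n`. -/
def weightQ (n i c : ℕ) : ℤ :=
  if i < n then if Even i then (if c = 0 then 1 else 2) else (if c = 0 then 0 else 2 * c - 1)
  else if i = n then if Even i then 2 else 2 * c
  else if Even i then (if c = 0 then 1 else 0) else (if c = 0 then 0 else 1)

/-- The local weights whose product is `2 ^ nuD` on partitions without multiples of `3`. -/
def weightC (i c : ℕ) : ℤ :=
  if 3 ∣ i then (if c = 0 then 1 else 0) else (if c = 0 then 1 else 2)

/-- The common part of the local generating functions for `R` and `Q`. -/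
noncomputable def coreFactor (n i : ℕ) : PowerSeries ℤ :=
  (if i < n then (1 + X ^ i) * geom i else if i = n then 2 * geom i else 1) *
    (if Even i then 1 else geom i)

/-- With x = X^i, the six cases are (x+x²)/(1-x) and (1+x)/(1-x)² below n, 2x²/(1-x) and 2x/(1-x)²
at n, and x and 1/(1-x) above n (even, then odd i). The monomial prefactor records the minimal
forced multiplicity of i. -/
theorem dilate_weightR (n : ℕ) {i : ℕ} (hi : i ≠ 0) :
    dilate i (weightR n i) =
      (if Even i then X ^ i else 1) * (if i = n then X ^ i else 1) * coreFactor n i := by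
  rcases lt_trichotomy i n with h | h | h
  · by_cases he : Even i
    · rw [dilate_eq_quad_mul_geom hi 0 1 1 (by simp [weightR, h, he]) (by simp [weightR, h, he])
        (by simp [weightR, h, he])]
      simp [coreFactor, h, he, h.ne]
      ring
    · rw [dilate_eq_quad_mul_geom_sq hi 1 1 0 (by simp [weightR, h, he])
        (fun c => by simp [weightR, h, he]; ring)]
      simp [coreFactor, h, he, h.ne, mul_assoc]
  · subst h
    by_cases he : Even i
    · rw [dilate_eq_quad_mul_geom hi 0 0 2 (by simp [weightR, he]) (by simp [weightR, he])
        (by simp [weightR, he])]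
      simp [coreFactor, he]
      ring
    · rw [dilate_eq_quad_mul_geom_sq hi 0 2 0 (by simp [weightR, he])
        (fun c => by simp [weightR, he])]
      simp [coreFactor, he]
      ring
  · by_cases he : Even i
    · have : weightR n i = quadCoeff 0 1 0 := by
        funext c; simp [weightR, quadCoeff, h.not_gt, h.ne', he]; grind
      rw [this, dilate_quadCoeff hi]
      simp [coreFactor, h.not_gt, h.ne', he]
    · rw [dilate_eq_quad_mul_geom hi 1 0 0 (by simp [weightR, h.not_gt, h.ne', he])
        (by simp [weightR, h.not_gt, h.ne', he]) (by simp [weightR, h.not_gt, h.ne', he])]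
      simp [coreFactor, h.not_gt, h.ne', he]

/-- The same six rational functions as for R up to a power of X^i; now the odd parts are the forced
ones. -/
theorem dilate_weightQ (n : ℕ) {i : ℕ} (hi : i ≠ 0) :
    dilate i (weightQ n i) = (if Even i then 1 else X ^ i) * coreFactor n i := by
  rcases lt_trichotomy i n with h | h | h
  · by_cases he : Even i
    · rw [dilate_eq_quad_mul_geom hi 1 1 0 (by simp [weightQ, h, he]) (by simp [weightQ, h, he])
        (by simp [weightQ, h, he])]
      simp [coreFactor, h, he]
    · rw [dilate_eq_quad_mul_geom_sq hi 0 1 1 (by simp [weightQ, h, he])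
        (fun c => by simp [weightQ, h, he]; ring)]
      simp [coreFactor, h, he]
      ring
  · subst h
    by_cases he : Even i
    · rw [dilate_eq_quad_mul_geom hi 2 0 0 (by simp [weightQ, he]) (by simp [weightQ, he])
        (by simp [weightQ, he])]
      simp [coreFactor, he]
    · rw [dilate_eq_quad_mul_geom_sq hi 0 2 0 (by simp [weightQ, he])
        (fun c => by simp [weightQ, he])]
      simp [coreFactor, he]
      ring
  · by_cases he : Even i
    · have : weightQ n i = quadCoeff 1 0 0 := by
        funext c; simp [weightQ, quadCoeff, h.not_gt, h.ne', he]
      rw [this, dilate_quadCoeff hi]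
      simp [coreFactor, h.not_gt, h.ne', he]
    · rw [dilate_eq_quad_mul_geom hi 0 1 0 (by simp [weightQ, h.not_gt, h.ne', he])
        (by simp [weightQ, h.not_gt, h.ne', he]) (by simp [weightQ, h.not_gt, h.ne', he])]
      simp [coreFactor, h.not_gt, h.ne', he]

theorem dilate_weightC {i : ℕ} (hi : i ≠ 0) :
    dilate i (weightC i) = if 3 ∣ i then 1 else (1 + X ^ i) * geom i := by
  by_cases h : 3 ∣ i
  · have : weightC i = quadCoeff 1 0 0 := by
      funext c; simp [weightC, quadCoeff, h]
    rw [this, dilate_quadCoeff hi]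
    simp [h]
  · rw [dilate_eq_quad_mul_geom hi 1 1 0 (by simp [weightC, h]) (by simp [weightC, h])
      (by simp [weightC, h])]
    simp [h]

theorem prod_dilate_weightC (L : ℕ) :
    ∏ i ∈ Icc 1 (3 * L), dilate i (weightC i) =
      ∏ k ∈ range L, (((1 + X ^ (3 * k + 1)) * (1 + X ^ (3 * k + 2))) *
        (geom (3 * k + 1) * geom (3 * k + 2))) := by
  induction L with
  | zero => simp
  | succ L ih =>
    rw [show 3 * (L + 1) = 3 * L + 1 + 1 + 1 by ring, prod_Icc_succ_top (by omega),
      prod_Icc_succ_top (by omega), prod_Icc_succ_top (by omega), ih, prod_range_succ,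
      dilate_weightC (by omega), dilate_weightC (by omega), dilate_weightC (by omega),
      if_neg (by omega), if_neg (by omega), if_pos (by omega)]
    ring

/-! ### Assembling the local factors into the hypergeometric term -/

theorem prod_Icc_parity {R : Type*} [CommMonoid R] (F : ℕ → R) {n : ℕ} (hn : 0 < n) :
    ∏ i ∈ Icc 1 (2 * n - 1), F i =
      (∏ j ∈ range n, F (2 * j + 1)) * ∏ j ∈ Icc 1 (n - 1), F (2 * j) := by
  induction n, hn using Nat.le_induction with
  | base => simp
  | succ n hn ih =>
    obtain ⟨m, rfl⟩ := Nat.exists_eq_succ_of_ne_zero (by omega : n ≠ 0)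
    rw [Nat.succ_eq_add_one] at *
    rw [show 2 * (m + 1 + 1) - 1 = 2 * (m + 1) - 1 + 1 + 1 by omega, prod_Icc_succ_top (by omega),
      prod_Icc_succ_top (by omega), ih, prod_range_succ (n := m + 1), Nat.add_sub_cancel, Nat.add_sub_cancel,
      prod_Icc_succ_top (by omega), show 2 * (m + 1) - 1 + 1 = 2 * (m + 1) by omega]
    simp only [mul_assoc, mul_comm, mul_left_comm]

theorem geom_two_mul {k : ℕ} (hk : k ≠ 0) : geom (2 * k) * (1 + X ^ k) = geom k := by
  have h1 := one_sub_mul_geom hk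
  have h2 := one_sub_mul_geom (i := 2 * k) (by omega)
  linear_combination (-(geom (2 * k) * (1 + X ^ k))) * h1 + geom k * h2

/-- (1+q^k)/(1-q^{2k}) = 1/(1-q^k) clears the even factors of (q;q)_{2n}. -/
theorem invPoch_two_mul (n : ℕ) :
    invPoch 1 (2 * n) * ∏ k ∈ range n, (1 + X ^ (k + 1)) =
      (∏ k ∈ range n, geom (2 * k + 1)) * ∏ k ∈ range n, geom (k + 1) := by
  induction n with
  | zero => simp [invPoch]
  | succ n ih =>
    have h : geom (2 * (n + 1)) * (1 + X ^ (n + 1)) = geom (n + 1) := geom_two_mul n.succ_ne_zero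
    rw [show 2 * (n + 1) = 2 * n + 1 + 1 by ring] at *
    simp only [invPoch, one_mul, prod_range_succ] at *
    rw [← h]
    linear_combination (geom (2 * n + 1) * geom (2 * n + 1 + 1) * (1 + X ^ (n + 1))) * ih

/-- The factor 2 at i = n plays the role of 1 + X^0 in (-1;q)_n. -/
theorem prod_coreFactor {n : ℕ} (hn : 0 < n) :
    ∏ i ∈ Icc 1 (2 * n - 1), coreFactor n i =
      invPoch 1 (2 * n) * ∏ k ∈ range n, ((1 + X ^ k) * (1 + X ^ (k + 1))) := by
  have h1 : ∏ i ∈ Icc 1 (2 * n - 1), (if Even i then (1 : PowerSeries ℤ) else geom i) =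
      ∏ k ∈ range n, geom (2 * k + 1) := by
    rw [prod_Icc_parity _ hn]
    simp
  have h2 : ∏ i ∈ Icc 1 (2 * n - 1),
      (if i < n then (1 + X ^ i) * geom i else if i = n then 2 * geom i else 1) =
      (∏ k ∈ range n, (1 + X ^ k)) * ∏ k ∈ range n, geom (k + 1) := by
    obtain ⟨m, rfl⟩ := Nat.exists_eq_succ_of_ne_zero (by omega : n ≠ 0)
    rw [Nat.succ_eq_add_one] at *
    rw [← prod_subset (s₁ := Icc 1 (m + 1)) (Icc_subset_Icc_right (by omega))
      fun i _ hi => ?_, prod_Icc_succ_top (by omega), prod_range_succ' (n := m) (fun k => 1 + X ^ k),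
      prod_range_succ (n := m)]
    · have : ∏ i ∈ Icc 1 m,
          (if i < m + 1 then (1 + X ^ i) * geom i else if i = m + 1 then 2 * geom i else 1) =
          ∏ k ∈ range m, ((1 + X ^ (k + 1)) * geom (k + 1)) := by
        rw [range_eq_Ico, prod_Ico_add' (fun i => (1 + X ^ i) * geom i) 0 m 1]
        refine prod_congr (by ext; simp) fun i hi => ?_
        rw [if_pos]
        simp at hi; omega
      rw [this, prod_mul_distrib]
      simp
      ring
    · rw [if_neg, if_neg] <;> simp at * <;> omega
  simp only [coreFactor]
  rw [prod_mul_distrib, h1, h2, prod_mul_distrib, mul_left_comm, invPoch_two_mul]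
  ring

theorem prod_dilate_weightQ {n : ℕ} (hn : 0 < n) :
    ∏ i ∈ Icc 1 (2 * n - 1), dilate i (weightQ n i) = hyperTerm n := by
  rw [prod_congr rfl fun i hi => dilate_weightQ n (i := i) (by simp at hi; omega),
    prod_mul_distrib, prod_coreFactor hn, hyperTerm, prod_Icc_parity _ hn]
  have : ∏ j ∈ range n, (X : PowerSeries ℤ) ^ (2 * j + 1) = X ^ (n * n) := by
    rw [prod_pow_eq_pow_sum, sum_add_distrib, ← mul_sum, sum_range_eq_choose_two, sum_const,
      card_range, smul_eq_mul, mul_one, two_mul_choose_two]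
  simp [this, mul_assoc]

theorem prod_dilate_weightR {n : ℕ} (hn : 0 < n) :
    ∏ i ∈ Icc 1 (2 * n - 1), dilate i (weightR n i) = hyperTerm n := by
  rw [prod_congr rfl fun i hi => dilate_weightR n (i := i) (by simp at hi; omega),
    prod_mul_distrib, prod_mul_distrib, prod_coreFactor hn, hyperTerm, prod_Icc_parity _ hn]
  have h1 : ∏ j ∈ Icc 1 (n - 1), (X : PowerSeries ℤ) ^ (2 * j) = X ^ (2 * n.choose 2) := by
    rw [prod_pow_eq_pow_sum, ← mul_sum, ← sum_range_eq_choose_two]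
    congr 2
    obtain ⟨m, rfl⟩ := Nat.exists_eq_succ_of_ne_zero (by omega : n ≠ 0)
    rw [Nat.succ_eq_add_one] at *
    rw [sum_range_succ', range_eq_Ico, sum_Ico_add' (fun k => k) 0 m 1]
    rfl
  have h2 : ∏ i ∈ Icc 1 (2 * n - 1), (if i = n then (X : PowerSeries ℤ) ^ i else 1) = X ^ n := by
    rw [prod_ite_eq' _ n, if_pos (by simp; omega)]
  rw [h2, ← two_mul_choose_two, pow_add, ← h1]
  simp [mul_assoc]

/-! ### From local weights back to the partitions -/

/-- The defining conditions of `R` for a given `n`. -/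
def InRAt {N : ℕ} (n : ℕ) (π : N.Partition) : Prop :=
  0 < n ∧
    (∀ i ∈ π.parts, i ≤ 2 * n - 1) ∧
    (∀ k : ℕ, 0 < k → Even k → k ≤ 2 * n - 2 → k ∈ π.parts) ∧
    (1 + chi (Even n) ≤ (freq π n : ℤ)) ∧
    (∀ k : ℕ, Even k → n < k → freq π k ≤ 1)

/-- The defining conditions of `Q` for a given `n`. -/
def InQAt {N : ℕ} (n : ℕ) (π : N.Partition) : Prop :=
  0 < n ∧
    largestPart π = 2 * n - 1 ∧
    (∀ k : ℕ, Odd k → k ≤ 2 * n - 1 → k ∈ π.parts) ∧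
    (∀ k : ℕ, Even k → n < k → k ∉ π.parts)

theorem freq_pos {N : ℕ} {π : N.Partition} {i : ℕ} : 0 < freq π i ↔ i ∈ π.parts :=
  Multiset.count_pos

theorem freq_eq_zero {N : ℕ} {π : N.Partition} {i : ℕ} : freq π i = 0 ↔ i ∉ π.parts :=
  Multiset.count_eq_zero

theorem InRAt.nR_eq {N n : ℕ} {π : N.Partition} (h : InRAt n π) : nR π = n := by
  obtain ⟨hn, hle, hev, -, -⟩ := h
  have : largestEvenPart π = 2 * n - 2 := by
    apply le_antisymm
    · refine Multiset.sup_le.mpr fun i hi => ?_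
      rw [Multiset.mem_filter] at hi
      have := hle i hi.1
      obtain ⟨k, hk⟩ := hi.2
      omega
    · rcases Nat.eq_zero_or_pos (2 * n - 2) with h0 | h0
      · omega
      · have he : Even (2 * n - 2) := ⟨n - 1, by omega⟩
        exact Multiset.le_sup (Multiset.mem_filter.mpr ⟨hev _ h0 he le_rfl, he⟩)
  rw [nR, this]
  omega

theorem InQAt.nQ_eq {N n : ℕ} {π : N.Partition} (h : InQAt n π) : nQ π = n := by
  obtain ⟨hn, hl, -, -⟩ := h
  rw [nQ, hl]
  omega

theorem InRAt.le {N n : ℕ} {π : N.Partition} (h : InRAt n π) : n ≤ N := by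
  have h4 := h.2.2.2.1
  have : 0 < freq π n := by
    unfold chi at h4
    split_ifs at h4 <;> omega
  exact Nat.Partition.le_of_mem_parts (freq_pos.mp this)

theorem InQAt.le {N n : ℕ} {π : N.Partition} (h : InQAt n π) : n ≤ N := by
  have hn := h.1
  have : 2 * n - 1 ∈ π.parts := h.2.2.1 _ ⟨n - 1, by omega⟩ le_rfl
  have := Nat.Partition.le_of_mem_parts this
  omega

/-- Isolates the exceptional factor at i = n, which sits in the odd or in the even product according
to the parity of n. -/
theorem prod_odd_ite {n : ℕ} (hn : 0 < n) (x : ℤ) :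
    ∏ j ∈ range n, (if 2 * j + 1 = n then x else 1) = if Odd n then x else 1 := by
  split_ifs with h
  · obtain ⟨m, rfl⟩ := h
    rw [prod_eq_single m (fun j _ hj => if_neg (by omega))
      (fun hm => absurd (mem_range.mpr (by omega)) hm), if_pos rfl]
  · exact prod_eq_one fun j _ => if_neg fun hj => h ⟨j, hj.symm⟩

theorem prod_even_ite {n : ℕ} (hn : 0 < n) (x : ℤ) :
    ∏ j ∈ Icc 1 (n - 1), (if 2 * j = n then x else 1) = if Even n then x else 1 := by
  split_ifs with h
  · obtain ⟨m, rfl⟩ := h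
    rw [prod_eq_single m (fun j _ hj => if_neg (by omega))
      (fun hm => absurd (mem_Icc.mpr (by omega)) hm), if_pos (by omega)]
  · exact prod_eq_one fun j _ => if_neg fun hj => h ⟨j, by omega⟩

theorem InRAt.prod_weightR {N n : ℕ} {π : N.Partition} (h : InRAt n π) :
    ∏ i ∈ Icc 1 (2 * n - 1), weightR n i (freq π i) = mu π := by
  have hnR := h.nR_eq
  obtain ⟨hn, hle, hev, hf, hrep⟩ := h
  have hodd : ∏ j ∈ range n, weightR n (2 * j + 1) (freq π (2 * j + 1)) =
      (∏ j ∈ range n with 2 * j + 1 < n, (2 * (freq π (2 * j + 1) : ℤ) + 1)) *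
        if Odd n then 2 * (freq π n : ℤ) else 1 := by
    rw [← prod_odd_ite hn, prod_filter, ← prod_mul_distrib]
    refine prod_congr rfl fun j _ => ?_
    have ho : ¬ Even (2 * j + 1) := by simp
    rcases lt_trichotomy (2 * j + 1) n with hlt | heq | hgt
    · simp only [weightR, if_pos hlt, if_neg ho, if_neg hlt.ne, mul_one]
    · subst heq
      simp [weightR]
    · simp [weightR, hgt.not_gt, hgt.ne']
  have heven : ∏ j ∈ Icc 1 (n - 1), weightR n (2 * j) (freq π (2 * j)) = 2 ^ delta π := by
    rw [delta, hnR, ← prod_pow_eq_pow_sum]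
    refine prod_congr rfl fun j hj => ?_
    rw [mem_Icc] at hj
    have he : Even (2 * j) := even_two_mul j
    have hpos := freq_pos.mpr (hev (2 * j) (by omega) he (by omega))
    rcases lt_trichotomy (2 * j) n with hlt | heq | hgt
    · simp only [weightR, if_pos hlt, if_pos he]
      split_ifs <;> omega
    · subst heq
      -- For even n the condition is f_n ≥ 2, so n always counts in δ; hence the constant weight 2
      -- at i = n.
      simp only [chi, he, if_true] at hf
      have : 1 < freq π (2 * j) := by omega
      simp [weightR, this, Nat.not_lt.mpr this]
    · have := hrep _ he hgt
      simp only [weightR, if_neg hgt.not_gt, if_neg hgt.ne', if_pos he]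
      split_ifs <;> omega
  rw [prod_Icc_parity _ hn, hodd, heven, mu, gamma, hnR, chi, chi]
  by_cases ho : Odd n
  · have he : ¬ Even n := Nat.not_even_iff_odd.mpr ho
    simp only [ho, he, if_true, if_false]
    ring
  · have he : Even n := Nat.not_odd_iff_even.mp ho
    simp only [ho, he, if_true, if_false]
    ring

/-- Apart from the bound on the parts, each condition of R is the nonvanishing of certain local
factors, so partitions outside R contribute nothing. -/
theorem inRAt_of_prod_ne_zero {N n : ℕ} (hn : 0 < n) {π : N.Partition}
    (hle : ∀ i ∈ π.parts, i ≤ 2 * n - 1)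
    (h : ∏ i ∈ Icc 1 (2 * n - 1), weightR n i (freq π i) ≠ 0) : InRAt n π := by
  rw [prod_ne_zero_iff] at h
  refine ⟨hn, hle, fun k hk he hkn => ?_, ?_, fun k he hnk => ?_⟩
  · have := h k (mem_Icc.mpr (by omega))
    rw [← freq_pos]
    contrapose! this
    have h0 : freq π k = 0 := by omega
    simp [weightR, he, h0]
  · have := h n (mem_Icc.mpr (by omega))
    by_cases he : Even n
    · simp [weightR, he] at this
      simp [chi, he]
      omega
    · simp [weightR, he] at this
      simp [chi, he]
      omega
  · by_cases hk : k ∈ π.parts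
    · have := h k (mem_Icc.mpr ⟨by omega, hle k hk⟩)
      simp [weightR, he, hnk.not_gt, hnk.ne'] at this
      exact this.le
    · rw [freq_eq_zero.mpr hk]
      omega

theorem InQAt.prod_weightQ {N n : ℕ} {π : N.Partition} (h : InQAt n π) :
    ∏ i ∈ Icc 1 (2 * n - 1), weightQ n i (freq π i) = eta π := by
  have hnQ := h.nQ_eq
  obtain ⟨hn, hle, hod, hev⟩ := h
  have hodd : ∏ j ∈ range n, weightQ n (2 * j + 1) (freq π (2 * j + 1)) =
      (∏ j ∈ range n with 2 * j + 1 < n, (2 * (freq π (2 * j + 1) : ℤ) - 1)) *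
        if Odd n then 2 * (freq π n : ℤ) else 1 := by
    rw [← prod_odd_ite hn, prod_filter, ← prod_mul_distrib]
    refine prod_congr rfl fun j hj => ?_
    rw [mem_range] at hj
    have ho : ¬ Even (2 * j + 1) := by simp
    have hpos := (freq_pos.mpr (hod (2 * j + 1) ⟨j, rfl⟩ (by omega))).ne'
    rcases lt_trichotomy (2 * j + 1) n with hlt | heq | hgt
    · simp only [weightQ, if_pos hlt, if_neg ho, if_neg hlt.ne, mul_one, if_neg hpos]
    · subst heq
      simp [weightQ]
    · simp [weightQ, hgt.not_gt, hgt.ne', hpos]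
  have hcard : (2 : ℤ) ^ nuDE π = ∏ j ∈ Icc 1 (n - 1), if freq π (2 * j) = 0 then 1 else 2 := by
    have h1 : (2 : ℤ) ^ nuDE π = ∏ i ∈ Icc 1 (2 * n - 1),
        if Even i ∧ i ∈ π.parts then (2 : ℤ) else 1 := by
      rw [nuDE, ← prod_const, ← prod_filter]
      refine prod_congr ?_ fun _ _ => rfl
      ext i
      simp only [mem_filter, Multiset.mem_toFinset, mem_Icc]
      refine ⟨fun hi => ⟨⟨π.parts_pos hi.1, ?_⟩, hi.2, hi.1⟩, fun hi => ⟨hi.2.2, hi.2.1⟩⟩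
      rw [← hle]
      exact Multiset.le_sup hi.1
    rw [h1, prod_Icc_parity _ hn, prod_eq_one fun j _ => if_neg (by simp), one_mul]
    refine prod_congr rfl fun j _ => ?_
    simp only [even_two_mul, true_and, freq_eq_zero]
    split_ifs <;> simp_all
  have heven : ∏ j ∈ Icc 1 (n - 1), weightQ n (2 * j) (freq π (2 * j)) =
      2 ^ nuDE π * if Even n then 1 + chi (freq π n = 0) else 1 := by
    rw [← prod_even_ite hn, hcard, ← prod_mul_distrib]
    refine prod_congr rfl fun j hj => ?_
    have he : Even (2 * j) := even_two_mul j
    rcases lt_trichotomy (2 * j) n with hlt | heq | hgt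
    · simp only [weightQ, if_pos hlt, if_pos he, if_neg hlt.ne, mul_one]
    · subst heq
      -- The factor 1+χ(f_n=0) supplies the 2 missing from `2 ^ nuDE π` when n is not a part, so the
      -- weight at an even n is always 2.
      simp only [weightQ, chi, lt_irrefl, he, if_true, if_false]
      split_ifs <;> norm_num
    · have := freq_eq_zero.mpr (hev _ he hgt)
      simp [weightQ, hgt.not_gt, hgt.ne', this]
  rw [prod_Icc_parity _ hn, hodd, heven, eta, hnQ, chi, chi, chi]
  by_cases ho : Odd n
  · have he : ¬ Even n := Nat.not_even_iff_odd.mpr ho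
    simp only [ho, he, if_true, if_false]
    ring
  · have he : Even n := Nat.not_odd_iff_even.mp ho
    simp only [ho, he, if_true, if_false]
    ring

theorem inQAt_of_prod_ne_zero {N n : ℕ} (hn : 0 < n) {π : N.Partition}
    (hle : ∀ i ∈ π.parts, i ≤ 2 * n - 1)
    (h : ∏ i ∈ Icc 1 (2 * n - 1), weightQ n i (freq π i) ≠ 0) : InQAt n π := by
  rw [prod_ne_zero_iff] at h
  have hod : ∀ k : ℕ, Odd k → k ≤ 2 * n - 1 → k ∈ π.parts := fun k ho hkn => by
    have := h k (mem_Icc.mpr ⟨ho.pos, hkn⟩)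
    rw [← freq_pos]
    contrapose! this
    have h0 : freq π k = 0 := by omega
    have he : ¬ Even k := Nat.not_even_iff_odd.mpr ho
    simp [weightQ, he, h0]
  refine ⟨hn, le_antisymm (Multiset.sup_le.mpr hle)
    (Multiset.le_sup (hod _ ⟨n - 1, by omega⟩ le_rfl)), hod, fun k he hnk hk => ?_⟩
  have := h k (mem_Icc.mpr ⟨by omega, hle k hk⟩)
  simp [weightQ, he, hnk.not_gt, hnk.ne', freq_eq_zero, hk] at this

open Classical in
/-- If local weights cut out the predicate `P n` and have product `w` there, and `P n` determines
`n`, then the weighted generating function of `∃ n, P n` is a sum of products of local factors. -/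
theorem coeff_weightedGF_eq_sum {N : ℕ} (S : ∀ {N : ℕ}, N.Partition → Prop)
    (w : ∀ {N : ℕ}, N.Partition → ℤ) (P : ℕ → N.Partition → Prop) (m : N.Partition → ℕ)
    (W : ℕ → ℕ → ℕ → ℤ) (hS : ∀ π : N.Partition, S π ↔ ∃ n, P n π)
    (hm : ∀ n π, P n π → m π = n) (hpos : ∀ n π, P n π → 0 < n ∧ n ≤ N)
    (hle : ∀ n π, P n π → ∀ i ∈ π.parts, i ≤ 2 * n - 1)
    (hW : ∀ n π, P n π → ∏ i ∈ Icc 1 (2 * n - 1), W n i (freq π i) = w π)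
    (hW' : ∀ n (π : N.Partition), 0 < n → (∀ i ∈ π.parts, i ≤ 2 * n - 1) →
      ∏ i ∈ Icc 1 (2 * n - 1), W n i (freq π i) ≠ 0 → P n π) :
    coeff N (weightedGF S w) =
      ∑ n ∈ Icc 1 N, coeff N (∏ i ∈ Icc 1 (2 * n - 1), dilate i (W n i)) := by
  have hn : ∀ n ∈ Icc 1 N, coeff N (∏ i ∈ Icc 1 (2 * n - 1), dilate i (W n i)) =
      ∑ π : N.Partition, if P n π then w π else 0 := fun n hn => by
    rw [coeff_prod_dilate, sum_filter]
    refine sum_congr rfl fun π _ => ?_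
    by_cases hP : P n π
    · rw [if_pos (hle n π hP), if_pos hP, hW n π hP]
    · rw [if_neg hP]
      split_ifs with h
      · by_contra h'
        exact hP (hW' n π (mem_Icc.mp hn).1 h h')
      · rfl
  rw [sum_congr rfl hn, sum_comm, weightedGF, coeff_mk, sum_filter]
  refine sum_congr rfl fun π _ => ?_
  split_ifs with h
  · obtain ⟨n, hP⟩ := (hS π).mp h
    rw [sum_eq_single n (fun k _ hk => if_neg fun hk' => hk ((hm k π hk').symm.trans (hm n π hP)))
      (fun hn' => absurd (mem_Icc.mpr (hpos n π hP)) hn'), if_pos hP]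
  · exact (sum_eq_zero fun n _ => if_neg fun hP => h ((hS π).mpr ⟨n, hP⟩)).symm

theorem coeff_weightedGF_InR (N : ℕ) :
    coeff N (weightedGF InR mu) = ∑ n ∈ Icc 1 N, coeff N (hyperTerm n) := by
  rw [coeff_weightedGF_eq_sum InR mu InRAt nR weightR (fun _ => Iff.rfl) (fun _ _ h => h.nR_eq)
    (fun _ _ h => ⟨h.1, h.le⟩) (fun _ _ h => h.2.1) (fun _ _ h => h.prod_weightR)
    (fun _ _ hn hle h => inRAt_of_prod_ne_zero hn hle h)]
  exact sum_congr rfl fun n hn => by rw [prod_dilate_weightR (mem_Icc.mp hn).1]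

theorem coeff_weightedGF_InQ (N : ℕ) :
    coeff N (weightedGF InQ eta) = ∑ n ∈ Icc 1 N, coeff N (hyperTerm n) := by
  rw [coeff_weightedGF_eq_sum InQ eta InQAt nQ weightQ (fun _ => Iff.rfl) (fun _ _ h => h.nQ_eq)
    (fun _ _ h => ⟨h.1, h.le⟩) (fun _ _ h i hi => h.2.1 ▸ Multiset.le_sup hi)
    (fun _ _ h => h.prod_weightQ) (fun _ _ hn hle h => inQAt_of_prod_ne_zero hn hle h)]
  exact sum_congr rfl fun n hn => by rw [prod_dilate_weightQ (mem_Icc.mp hn).1]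

theorem prod_weightC {N M : ℕ} (hM : N ≤ M) (π : N.Partition) :
    ∏ i ∈ Icc 1 M, weightC i (freq π i) =
      if ∀ i ∈ π.parts, ¬ 3 ∣ i then 2 ^ nuD π else 0 := by
  have hsub : π.parts.toFinset ⊆ Icc 1 M := fun i hi => by
    rw [Multiset.mem_toFinset] at hi
    exact mem_Icc.mpr ⟨π.parts_pos hi, (Nat.Partition.le_of_mem_parts hi).trans hM⟩
  split_ifs with h
  · rw [nuD, ← prod_const]
    symm
    refine prod_subset_one_on_sdiff hsub (fun i hi => ?_) (fun i hi => ?_)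
    · rw [mem_sdiff, Multiset.mem_toFinset, ← freq_eq_zero] at hi
      simp [weightC, hi.2]
    · rw [Multiset.mem_toFinset] at hi
      simp [weightC, h i hi, freq_eq_zero, hi]
  · push Not at h
    obtain ⟨i, hi, h3⟩ := h
    refine prod_eq_zero (hsub (Multiset.mem_toFinset.mpr hi)) ?_
    simp [weightC, h3, freq_eq_zero, hi]

theorem coeff_weightedGF_InC (N : ℕ) :
    coeff N (weightedGF InC fun π => 2 ^ nuD π) = ∑ n ∈ Icc 1 N, coeff N (hyperTerm n) := by
  classical
  have hd := X_pow_dvd_iff.mp (X_pow_dvd_sum_hyperTerm_sub (N + 1)) N N.lt_succ_self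
  -- The term n = 0 is the constant 1; it accounts for the empty partition, which the product counts
  -- and `InC` excludes.
  have h0 : hyperTerm 0 = 1 := by simp [hyperTerm, invPoch]
  have hI : ∑ n ∈ range (N + 1), coeff N (hyperTerm n) =
      ∑ n ∈ Icc 1 N, coeff N (hyperTerm n) + coeff N (1 : PowerSeries ℤ) := by
    rw [sum_range_succ', h0, range_eq_Ico, sum_Ico_add' (fun n => coeff N (hyperTerm n)) 0 N 1]
    rfl
  rw [map_sub, sub_eq_zero, map_sum, hI, ← prod_dilate_weightC, coeff_prod_dilate, sum_filter] at hd
  rw [← add_left_inj (coeff N (1 : PowerSeries ℤ)), hd, weightedGF, coeff_mk, sum_filter]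
  have hle : ∀ π : N.Partition, ∀ i ∈ π.parts, i ≤ 3 * (2 * (N + 1)) := fun π i hi =>
    (Nat.Partition.le_of_mem_parts hi).trans (by omega)
  have hprod : ∀ π : N.Partition, (if ∀ i ∈ π.parts, i ≤ 3 * (2 * (N + 1)) then
      ∏ i ∈ Icc 1 (3 * (2 * (N + 1))), weightC i (freq π i) else 0) =
      if ∀ i ∈ π.parts, ¬ 3 ∣ i then 2 ^ nuD π else 0 := fun π => by
    rw [if_pos (hle π), prod_weightC (by omega)]
  rw [sum_congr rfl fun π _ => hprod π]
  rcases Nat.eq_zero_or_pos N with rfl | hN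
  · simp [InC, nuD]
  · have hne : ∀ π : N.Partition, π.parts ≠ 0 := fun π h => by
      have := π.parts_sum
      rw [h, Multiset.sum_zero] at this
      omega
    simp [InC, hne, coeff_one, hN.ne']

end WeightedPartitions

theorem mainTheorem12 :
    WeightedPartitions.weightedGF WeightedPartitions.InC
        (fun π => 2 ^ WeightedPartitions.nuD π) =
      WeightedPartitions.weightedGF WeightedPartitions.InR WeightedPartitions.mu ∧
    WeightedPartitions.weightedGF WeightedPartitions.InR WeightedPartitions.mu =
      WeightedPartitions.weightedGF WeightedPartitions.InQ WeightedPartitions.eta := by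
  constructor <;> ext N
  · rw [WeightedPartitions.coeff_weightedGF_InC, WeightedPartitions.coeff_weightedGF_InR]
  · rw [WeightedPartitions.coeff_weightedGF_InR, WeightedPartitions.coeff_weightedGF_InQ]
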